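/- **Setting.** For $n,d\ge 1$, a database is $D=(X|\mathbf y)$ with $X\in\mathbb R^{n\times d}$ (rows $\mathbf x_1,\dots,\mathbf x_n$, non-sensitive, known to the attacker) and sensitive $\mathbf y\in\{0,1\}^n$. For a kernel $\kappa$ let $K=(\kappa(\mathbf x_i,\mathbf x_j))_{i,j}$; for a regularization parameter $\lambda>0$ the kernel ridge regression coefficient vector is $\alpha^\star=(K+\lambda \mathbb I_n)^{-1}\mathbf y$ (whenever $K+\lambda\mathbb I_n$ is invertible; this is automatic if $\kappa$ is positive semidefinite). The polynomial kernel is $\kappa(\mathbf x,\mathbf y)=(a\langle \mathbf x,\mathbf y\rangle+b)^p$ with constants $a\in\mathbb R$, $b\ge 0$, $p\in\mathbb N$; the Gaussian kernel is $\kappa(\mathbf x,\mathbf y)=\exp(-a\|\mathbf x-\mathbf y\|^2)$ with a constant $a>0$. A randomized mechanism $\mathcal M:\mathbb R^{n\times(d+1)}\to\mathbb R^l$ allows $(\theta,\gamma)$ attribute reconstruction by the adversary $\mathcal A:\mathbb R^{n\times d}\times\mathbb R^l\to\mathbb R^n$ if there is an $X\in\mathbb R^{n\times d}$ such that for every $\mathbf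 y\in\{0,1\}^n$, $$\Pr_{\rho\leftarrow\mathcal M((X|\mathbf y))}\left[d_H(\mathbf y,\mathcal A(X,\rho))\le\theta\right]\ge 1-\gamma ,$$ where $d_H$ is the Hamming distance. A family of mechanisms (one for each $n$, with $d=d(n)$) is attribute non-private if for an infinite sequence of $n$ it allows $(o(n),o(1))$ attribute reconstruction by some adversary. The rounding attack maps $(X,\tilde\alpha)$ to $\hat{\mathbf y}\in\{0,1\}^n$ with $\hat y_i=0$ if the $i$th entry of $(K+\lambda\mathbb I_n)\tilde\alpha$ is $<1/2$, and $\hat y_i=1$ otherwise. **Proposition.** Let $d=d(n)\ge 1$ and $\lambda=\lambda(n)>0$ be arbitrary, and consider mechanisms that on every database $(X|\mathbf y)$, $X\in\mathbb R^{n\times d}$, $\mathbf y\in\{0,1\}^n$, release $\tilde\alpha=\alpha^\star+\mathbf e$, where the noise $\mathbf e$ is of arbitrary law and almost surely $|e_i|\le\beta(n)$ for all $i$. 1. If the kernel is polynomial and $\beta(n)=o\left(\frac{1}{d^pn+\lambda}\right)$ as $n\to\infty$, then the mechanism is attribute non-private. 2. If the kernel is Gaussian and $\beta(n)=o\left(\frac{1}{2+\lambda}\right)$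 as $n\to\infty$, then the mechanism is attribute non-private. In both cases this is achieved by the rounding attack, which gives $(o(n),o(1))$ attribute reconstruction along all $n$. The rounding attack is computed on a real random access machine (unit-cost real arithmetic, exponential and comparison) by a fixed program in at most $C\,d\,n^2$ steps for all $n,d\ge1$ and all inputs, where the program and $C$ depend only on the constants of the kernel. -/

import Mathlib

open Filter Asymptotics MeasureTheory Topology

noncomputable section

namespace KRR

/-! Kernel ridge regression -/

/-- The polynomial kernel `(a ⟨x, y⟩ + b) ^ p` on `ℝ^d`. -/
def polyKernel (a b : ℝ) (p : ℕ) {d : ℕ} (x y : Fin d → ℝ) : ℝ :=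
  (a * (∑ k, x k * y k) + b) ^ p

/-- The Gaussian kernel `exp (-a ‖x - y‖ ^ 2)` on `ℝ^d`, with the Euclidean norm. -/
def gaussKernel (a : ℝ) {d : ℕ} (x y : Fin d → ℝ) : ℝ :=
  Real.exp (-a * ∑ k, (x k - y k) ^ 2)

/-- The kernel matrix of the rows of `X`. -/
def kernelMatrix {n d : ℕ} (κ : (Fin d → ℝ) → (Fin d → ℝ) → ℝ)
    (X : Matrix (Fin n) (Fin d) ℝ) : Matrix (Fin n) (Fin n) ℝ :=
  Matrix.of fun i j => κ (X i) (X j)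

/-- The regularized kernel matrix `K + lam I`. -/
def regMatrix {n d : ℕ} (κ : (Fin d → ℝ) → (Fin d → ℝ) → ℝ) (lam : ℝ)
    (X : Matrix (Fin n) (Fin d) ℝ) : Matrix (Fin n) (Fin n) ℝ :=
  kernelMatrix κ X + lam • (1 : Matrix (Fin n) (Fin n) ℝ)

/-- The kernel ridge regression coefficient vector `(K + lam I)⁻¹ y`
(meaningful when `K + lam I` is invertible). -/
def coeffs {n d : ℕ} (κ : (Fin d → ℝ) → (Fin d → ℝ) → ℝ) (lam : ℝ)
    (X : Matrix (Fin n) (Fin d) ℝ) (y : Fin n → ℝ) : Fin n → ℝ :=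
  (regMatrix κ lam X)⁻¹.mulVec y

/-- The rounding attack: from the public `X` and released coefficients `ρ`, compute
`(K + lam I) ρ` and replace each entry by `0` if it is `< 1/2`, and by `1` otherwise. -/
def roundingAttack {n d : ℕ} (κ : (Fin d → ℝ) → (Fin d → ℝ) → ℝ) (lam : ℝ)
    (X : Matrix (Fin n) (Fin d) ℝ) (ρ : Fin n → ℝ) : Fin n → ℝ :=
  fun i => if (regMatrix κ lam X).mulVec ρ i < 1 / 2 then 0 else 1

/-! Mechanisms and failure of attribute privacy -/

/-- The database `(X | y)`: the matrix `X` with `y` appended as its last column. -/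
def database {n d : ℕ} (X : Matrix (Fin n) (Fin d) ℝ) (y : Fin n → ℝ) :
    Matrix (Fin n) (Fin (d + 1)) ℝ :=
  Matrix.of fun i => Fin.snoc (α := fun _ => ℝ) (X i) (y i)

/-- A randomized mechanism: every database is sent to the law of the released vector. -/
abbrev Mechanism (n d l : ℕ) : Type :=
  Matrix (Fin n) (Fin (d + 1)) ℝ → ProbabilityMeasure (Fin l → ℝ)

/-- `y ∈ {0,1}^n`. -/
def IsBinary {n : ℕ} (y : Fin n → ℝ) : Prop := ∀ i, y i = 0 ∨ y i = 1

/-- The adversary `A` achieves `(θ, γ)` attribute reconstruction against `M`: for some nonsensitive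
attributes `X`, for every sensitive vector `y`, the output of `A` is within Hamming distance `θ` of
`y` with probability at least `1 - γ` over the release. -/
def ReconstructsWith {n d l : ℕ} (M : Mechanism n d l)
    (A : Matrix (Fin n) (Fin d) ℝ → (Fin l → ℝ) → (Fin n → ℝ)) (θ γ : ℝ) : Prop :=
  (∀ X, Measurable (A X)) ∧
  ∃ X : Matrix (Fin n) (Fin d) ℝ, ∀ y : Fin n → ℝ, IsBinary y →
    1 - γ ≤ (M (database X y) : Measure (Fin l → ℝ)).real
      {ρ | (hammingDist y (A X ρ) : ℝ) ≤ θ}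

/-- `M` allows `(θ, γ)` attribute reconstruction. -/
def AllowsReconstruction {n d l : ℕ} (M : Mechanism n d l) (θ γ : ℝ) : Prop :=
  ∃ A : Matrix (Fin n) (Fin d) ℝ → (Fin l → ℝ) → (Fin n → ℝ), ReconstructsWith M A θ γ

/-- Attribute non-privacy of a family of mechanisms (`d = d n`): along an infinite sequence of `n`,
the mechanism allows `(o(n), o(1))` attribute reconstruction. -/
def AttributeNonprivate {d l : ℕ → ℕ} (M : ∀ n, Mechanism n (d n) (l n)) : Prop :=
  ∃ φ : ℕ → ℕ, StrictMono φ ∧ ∃ θ γ : ℕ → ℝ,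
    (θ =o[atTop] fun k => (φ k : ℝ)) ∧ Tendsto γ atTop (𝓝 0) ∧
    ∀ k, AllowsReconstruction (M (φ k)) (θ k) (γ k)

/-- The mechanism `M` releases the kernel ridge regression coefficients of every database `(X | y)`
with `y ∈ {0,1}^n` up to a noise vector, of any law, whose entries are at most `β` in absolute
value. (`K + lam I` is always invertible when `κ` is positive semidefinite and `lam > 0`.) -/
def ReleasesCoeffs {n d : ℕ} (κ : (Fin d → ℝ) → (Fin d → ℝ) → ℝ) (lam β : ℝ)
    (M : Mechanism n d n) : Prop :=
  ∀ (X : Matrix (Fin n) (Fin d) ℝ) (y : Fin n → ℝ), IsBinary y → IsUnit (regMatrix κ lam X) →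
    ∀ᵐ ρ ∂(M (database X y) : Measure (Fin n → ℝ)), ∀ i, |ρ i - coeffs κ lam X y i| ≤ β

/-! A real random access machine with step count -/

/-- A memory state: index registers, real registers, and random access arrays of reals. -/
structure State where
  idx : ℕ → ℕ
  reg : ℕ → ℝ
  mem : ℕ → ℕ → ℝ

/-- Programs of a real RAM. Index registers support only constants and addition; real registers
support constants, `+`, `-`, `*`, `exp` and comparison; arrays are accessed through index
registers. A program is a fixed finite text, independent of the size of the input. -/
inductive Program where
  /-- `idx[t] := c` -/
  | idxConst (t c : ℕ)
  /-- `idx[t] := idx[u] + idx[v]` -/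
  | idxAdd (t u v : ℕ)
  /-- `reg[t] := c` -/
  | const (t : ℕ) (c : ℝ)
  /-- `reg[t] := reg[u] + reg[v]` -/
  | add (t u v : ℕ)
  /-- `reg[t] := reg[u] - reg[v]` -/
  | sub (t u v : ℕ)
  /-- `reg[t] := reg[u] * reg[v]` -/
  | mul (t u v : ℕ)
  /-- `reg[t] := exp(reg[u])` -/
  | exp (t u : ℕ)
  /-- `reg[t] := mem[m][idx[u]]` -/
  | load (t m u : ℕ)
  /-- `mem[m][idx[u]] := reg[t]` -/
  | store (m u t : ℕ)
  /-- run the first program, then the second -/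
  | seq (P Q : Program)
  /-- `if reg[u] < reg[v] then P else Q` -/
  | ifLt (u v : ℕ) (P Q : Program)
  /-- run `P` as many times as `idx[u]` says when the loop is entered -/
  | loop (u : ℕ) (P : Program)

/-- Execution of a program: the final state and the number of steps. Every elementary instruction,
every test and every loop iteration (on top of its body) costs one step. -/
def Program.run : Program → State → State × ℕ
  | .idxConst t c, s => ({ s with idx := Function.update s.idx t c }, 1)
  | .idxAdd t u v, s => ({ s with idx := Function.update s.idx t (s.idx u + s.idx v) }, 1)
  | .const t c, s => ({ s with reg := Function.update s.reg t c }, 1)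
  | .add t u v, s => ({ s with reg := Function.update s.reg t (s.reg u + s.reg v) }, 1)
  | .sub t u v, s => ({ s with reg := Function.update s.reg t (s.reg u - s.reg v) }, 1)
  | .mul t u v, s => ({ s with reg := Function.update s.reg t (s.reg u * s.reg v) }, 1)
  | .exp t u, s => ({ s with reg := Function.update s.reg t (Real.exp (s.reg u)) }, 1)
  | .load t m u, s => ({ s with reg := Function.update s.reg t (s.mem m (s.idx u)) }, 1)
  | .store m u t, s =>
      (⟨s.idx, s.reg,
        Function.update s.mem m (Function.update (s.mem m) (s.idx u) (s.reg t))⟩, 1)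
  | .seq P Q, s => ((Q.run (P.run s).1).1, (P.run s).2 + (Q.run (P.run s).1).2)
  | .ifLt u v P Q, s =>
      if s.reg u < s.reg v then ((P.run s).1, (P.run s).2 + 1)
      else ((Q.run s).1, (Q.run s).2 + 1)
  | .loop u P, s =>
      (fun c : State × ℕ => ((P.run c.1).1, c.2 + (P.run c.1).2 + 1))^[s.idx u] (s, 1)

/-- The input of the attack: `n`, `d` in index registers `0`, `1`; `lam` in real register `0`; the
entries of `X` row by row in array `0`; the vector `ρ` in array `1`; everything else is `0`. -/
def inputState {n d : ℕ} (lam : ℝ) (X : Matrix (Fin n) (Fin d) ℝ) (ρ : Fin n → ℝ) : State where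
  idx r := if r = 0 then n else if r = 1 then d else 0
  reg r := if r = 0 then lam else 0
  mem m q :=
    if m = 0 then
      if h : q < n * d then
        X (finProdFinEquiv.symm ⟨q, h⟩).1 (finProdFinEquiv.symm ⟨q, h⟩).2
      else 0
    else if m = 1 then (if h : q < n then ρ ⟨q, h⟩ else 0)
    else 0

/-- On all inputs, `P` writes the result of the rounding attack for the kernel `κ` (given in all
dimensions) into array `2`, within `C * (d * n ^ 2)` steps. -/
def ComputesAttack (κ : ∀ d : ℕ, (Fin d → ℝ) → (Fin d → ℝ) → ℝ) (P : Program) (C : ℕ) : Prop :=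
  ∀ (n d : ℕ), 1 ≤ n → 1 ≤ d →
    ∀ (lam : ℝ) (X : Matrix (Fin n) (Fin d) ℝ) (ρ : Fin n → ℝ),
      (∀ i : Fin n, (P.run (inputState lam X ρ)).1.mem 2 i = roundingAttack (κ d) lam X ρ i) ∧
      (P.run (inputState lam X ρ)).2 ≤ C * (d * n ^ 2)

end KRR

end

noncomputable section

namespace KRR

/-! ### The rounding attack on the real random access machine -/

namespace Program

/-! Multiplying the release by the public matrix `K + lam I` gives `y + (K + lam I) e`, and each
entry of the error is at most `β` times an absolute row sum of the matrix. Once this is below `1 /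
2`, rounding returns `y` exactly (`roundingAttack_eq`). The definition of reconstruction leaves `X`
free, so it suffices to find one `X` with an invertible matrix and small row sums. For the
polynomial kernel, rows that are all the same small constant vector make `K` a constant matrix with
entries `O(d ^ p)`. For the Gaussian kernel, far apart rows make `K` nearly the identity, with row
sums below `2`. The `o` hypothesis then gives exact recovery for all large `n`; for the other `n`
the trivial distance `n` is allowed (`exists_reconstructsWith`). For the running time, both kernels
have the form `g (∑ k, f (x k) (y k))`, so one triple loop serves both. Its invariants carry the
correctness, and `run_loop` the step count. -/

/-- Hoare rule for loops with a cost. The number of iterations is fixed on entry; each costs its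
body plus one step, and entering costs one. -/
theorem run_loop (I : ℕ → State → Prop) {u : ℕ} {P : Program} {s : State} {c N : ℕ}
    (hN : s.idx u = N) (h0 : I 0 s)
    (hs : ∀ k t, k < N → I k t → I (k + 1) (P.run t).1 ∧ (P.run t).2 ≤ c) :
    I N ((loop u P).run s).1 ∧ ((loop u P).run s).2 ≤ 1 + N * (c + 1) := by
  have key : ∀ k ≤ N,
      I k ((fun c : State × ℕ => ((P.run c.1).1, c.2 + (P.run c.1).2 + 1))^[k] (s, 1)).1 ∧
      ((fun c : State × ℕ => ((P.run c.1).1, c.2 + (P.run c.1).2 + 1))^[k] (s, 1)).2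
        ≤ 1 + k * (c + 1) := by
    intro k
    induction k with
    | zero => intro _; simpa using h0
    | succ k ih =>
      intro hk
      obtain ⟨h1, h2⟩ := ih (by omega)
      obtain ⟨h3, h4⟩ := hs k _ (by omega) h1
      rw [Function.iterate_succ_apply']
      refine ⟨h3, ?_⟩
      dsimp only
      rw [Nat.succ_mul]
      omega
  have := key N le_rfl
  simpa only [run, hN] using this

/-- Combine the entries in real registers `4` and `5` into register `4` by `f`, in `c` steps. -/
def CombinesEntries (P : Program) (f : ℝ → ℝ → ℝ) (c : ℕ) : Prop :=
  ∀ s, P.run s = ({ s with reg := Function.update s.reg 4 (f (s.reg 4) (s.reg 5)) }, c)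

/-- Write `g` of real register `3` into register `10`, keeping registers `0`, `1`, `2`, the index
registers and the arrays, in `c` steps. -/
def Finishes (P : Program) (g : ℝ → ℝ) (c : ℕ) : Prop :=
  ∀ s, (P.run s).1.idx = s.idx ∧ (P.run s).1.mem = s.mem ∧
    (P.run s).1.reg 0 = s.reg 0 ∧ (P.run s).1.reg 1 = s.reg 1 ∧ (P.run s).1.reg 2 = s.reg 2 ∧
    (P.run s).1.reg 10 = g (s.reg 3) ∧ (P.run s).2 = c

/-- Multiply real register `10` by register `3`, `p` times. -/
def powLoop : ℕ → Program
  | 0 => const 10 1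
  | p + 1 => seq (powLoop p) (mul 10 10 3)

theorem run_powLoop (p : ℕ) (s : State) :
    (powLoop p).run s = ({ s with reg := Function.update s.reg 10 (s.reg 3 ^ p) }, p + 1) := by
  induction p with
  | zero => simp [powLoop, run]
  | succ p ih => simp [powLoop, run, ih, pow_succ]

/-- From the accumulated inner product to the polynomial kernel. -/
def polyFinish (a b : ℝ) (p : ℕ) : Program :=
  seq (const 11 a) (seq (mul 3 11 3) (seq (const 11 b) (seq (add 3 3 11) (powLoop p))))

theorem finishes_polyFinish (a b : ℝ) (p : ℕ) :
    (polyFinish a b p).Finishes (fun t => (a * t + b) ^ p) (p + 5) := by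
  intro s
  simp [polyFinish, run, run_powLoop]
  omega

/-- From the accumulated squared distance to the Gaussian kernel. -/
def gaussFinish (a : ℝ) : Program :=
  seq (const 11 (-a)) (seq (mul 3 11 3) (exp 10 3))

theorem finishes_gaussFinish (a : ℝ) :
    (gaussFinish a).Finishes (fun t => Real.exp (-a * t)) 3 := by
  intro s
  simp [gaussFinish, run]

/-- The square of the difference of two entries. -/
def sqDiff : Program := seq (sub 4 4 5) (mul 4 4 4)

theorem combinesEntries_mul : (mul 4 4 5).CombinesEntries (fun u v => u * v) 1 := by
  intro s
  simp [run]

theorem combinesEntries_sqDiff : sqDiff.CombinesEntries (fun u v => (u - v) ^ 2) 2 := by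
  intro s
  simp [sqDiff, run, pow_two]

/-- One coordinate of the accumulation over a pair of rows. -/
def coordStep (P : Program) : Program :=
  seq (load 4 0 7) (seq (load 5 0 5) (seq P
    (seq (add 3 3 4) (seq (idxAdd 7 7 4) (idxAdd 5 5 4)))))

/-- One column of the matrix-vector product, for the current row. -/
def columnStep (P Q : Program) : Program :=
  -- Index register `9` always holds `0`, so this addition copies the offset of the current row.
  seq (idxAdd 7 2 9) (seq (const 3 0) (seq (loop 1 (coordStep P)) (seq Q
    (seq (load 4 1 6) (seq (mul 10 10 4) (seq (add 2 2 10) (idxAdd 6 6 4)))))))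

/-- Add the regularization to the current row sum, round it and store the result. -/
def rowFinish : Program :=
  seq (idxAdd 2 2 1) (seq (load 4 1 3) (seq (mul 4 4 0) (seq (add 2 2 4)
    (seq (ifLt 2 1 (const 5 0) (const 5 1)) (seq (store 2 3 5) (idxAdd 3 3 4))))))

/-- One output entry of the attack. -/
def rowStep (P Q : Program) : Program :=
  seq (idxConst 5 0) (seq (idxConst 6 0) (seq (const 2 0)
    (seq (loop 0 (columnStep P Q)) rowFinish)))

/-- The rounding attack, for the kernel given by `P` and `Q`. -/
def attack (P Q : Program) : Program :=
  seq (idxConst 4 1) (seq (const 1 (1 / 2)) (loop 0 (rowStep P Q)))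

/-- The data that every stage of the attack keeps. -/
structure Frame (n d : ℕ) (lam : ℝ) (x r : ℕ → ℝ) (s : State) : Prop where
  idx0 : s.idx 0 = n
  idx1 : s.idx 1 = d
  idx4 : s.idx 4 = 1
  idx9 : s.idx 9 = 0
  reg0 : s.reg 0 = lam
  reg1 : s.reg 1 = 1 / 2
  mem0 : s.mem 0 = x
  mem1 : s.mem 1 = r

/-- Index registers cannot multiply, so the offsets `i * d` and `j * d` are maintained by
increments. -/
structure CoordInv (n d : ℕ) (lam : ℝ) (x r : ℕ → ℝ) (f : ℝ → ℝ → ℝ) (i j : ℕ) (acc : ℝ)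
    (out : ℕ → ℝ) (k : ℕ) (s : State) : Prop extends Frame n d lam x r s where
  idx2 : s.idx 2 = i * d
  idx3 : s.idx 3 = i
  idx6 : s.idx 6 = j
  idx7 : s.idx 7 = i * d + k
  idx5 : s.idx 5 = j * d + k
  reg2 : s.reg 2 = acc
  reg3 : s.reg 3 = ∑ k' ∈ Finset.range k, f (x (i * d + k')) (x (j * d + k'))
  mem2 : s.mem 2 = out

theorem run_coordStep {n d : ℕ} {lam : ℝ} {x r : ℕ → ℝ} {f : ℝ → ℝ → ℝ} {i j : ℕ} {acc : ℝ}
    {out : ℕ → ℝ} {k c : ℕ} {P : Program} {s : State} (hP : P.CombinesEntries f c)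
    (h : CoordInv n d lam x r f i j acc out k s) :
    CoordInv n d lam x r f i j acc out (k + 1) ((coordStep P).run s).1 ∧
      ((coordStep P).run s).2 ≤ c + 5 := by
  obtain ⟨⟨h0, h1, h4, h9, g0, g1, m0, m1⟩, h2, h3, h6, h7, h5, g2, g3, m2⟩ := h
  have hP' : ∀ s, P.run s =
    ({ s with reg := Function.update s.reg 4 (f (s.reg 4) (s.reg 5)) }, c) := hP
  refine ⟨⟨⟨?_, ?_, ?_, ?_, ?_, ?_, ?_, ?_⟩, ?_, ?_, ?_, ?_, ?_, ?_, ?_, ?_⟩, ?_⟩ <;>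
    simp [coordStep, run, *, Finset.sum_range_succ] <;> omega

/-- Register `5` needs no reset between columns: after `d` coordinates it stands at `j * d + d`, the
start of the next row. -/
structure ColumnInv (n d : ℕ) (lam : ℝ) (x r : ℕ → ℝ) (f : ℝ → ℝ → ℝ) (g : ℝ → ℝ) (i : ℕ)
    (out : ℕ → ℝ) (j : ℕ) (s : State) : Prop extends Frame n d lam x r s where
  idx2 : s.idx 2 = i * d
  idx3 : s.idx 3 = i
  idx6 : s.idx 6 = j
  idx5 : s.idx 5 = j * d
  reg2 : s.reg 2 = ∑ j' ∈ Finset.range j,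
    g (∑ k ∈ Finset.range d, f (x (i * d + k)) (x (j' * d + k))) * r j'
  mem2 : s.mem 2 = out

theorem run_columnStep {n d : ℕ} {lam : ℝ} {x r : ℕ → ℝ} {f : ℝ → ℝ → ℝ} {g : ℝ → ℝ} {i : ℕ}
    {out : ℕ → ℝ} {j c c' : ℕ} {P Q : Program} {s : State} (hP : P.CombinesEntries f c)
    (hQ : Q.Finishes g c') (h : ColumnInv n d lam x r f g i out j s) :
    ColumnInv n d lam x r f g i out (j + 1) ((columnStep P Q).run s).1 ∧
      ((columnStep P Q).run s).2 ≤ d * (c + 6) + c' + 7 := by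
  obtain ⟨⟨h0, h1, h4, h9, g0, g1, m0, m1⟩, h2, h3, h6, h5, g2, m2⟩ := h
  set s₁ : State := ((idxAdd 7 2 9).run s).1
  set s₂ : State := ((const 3 0).run s₁).1
  have hs₂ : CoordInv n d lam x r f i j (s.reg 2) out 0 s₂ := by
    refine ⟨⟨?_, ?_, ?_, ?_, ?_, ?_, ?_, ?_⟩, ?_, ?_, ?_, ?_, ?_, ?_, ?_, ?_⟩ <;>
      simp [s₂, s₁, run, *]
  obtain ⟨⟨⟨h0, h1, h4, h9, g0, g1, m0, m1⟩, h2, h3, h6, h7, h5, g2', g3, m2⟩, ht⟩ :=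
    run_loop (u := 1) (N := d) (c := c + 5) (CoordInv n d lam x r f i j (s.reg 2) out)
    hs₂.idx1 hs₂ fun k t _ ht => run_coordStep hP ht
  set s₃ : State := ((loop 1 (coordStep P)).run s₂).1
  obtain ⟨q1, q2, q3, q4, q5, q6, q7⟩ := hQ s₃
  -- Regrouping isolates the run of `Q`, which is known only through its specification.
  have e : (columnStep P Q).run s =
      ((((seq (load 4 1 6) (seq (mul 10 10 4) (seq (add 2 2 10) (idxAdd 6 6 4))))).run
        (Q.run s₃).1).1, 1 + (1 + (((loop 1 (coordStep P)).run s₂).2 + ((Q.run s₃).2 + 4)))) := rfl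
  rw [e]
  constructor
  · refine ⟨⟨?_, ?_, ?_, ?_, ?_, ?_, ?_, ?_⟩, ?_, ?_, ?_, ?_, ?_, ?_⟩ <;>
      simp [run, *, Finset.sum_range_succ, Nat.succ_mul]
  · change _ ≤ 1 + d * (c + 6) at ht
    change 1 + (1 + (_ + (_ + 4))) ≤ _
    omega

/-- The entry of the output of the attack with index `i`, on arrays. -/
def attackEntry (n d : ℕ) (lam : ℝ) (x r : ℕ → ℝ) (f : ℝ → ℝ → ℝ) (g : ℝ → ℝ) (i : ℕ) : ℝ :=
  if (∑ j ∈ Finset.range n,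
      g (∑ k ∈ Finset.range d, f (x (i * d + k)) (x (j * d + k))) * r j) + r i * lam < 1 / 2
    then 0 else 1

structure RowInv (n d : ℕ) (lam : ℝ) (x r : ℕ → ℝ) (f : ℝ → ℝ → ℝ) (g : ℝ → ℝ) (i : ℕ)
    (s : State) : Prop extends Frame n d lam x r s where
  idx2 : s.idx 2 = i * d
  idx3 : s.idx 3 = i
  mem2 : ∀ i' < i, s.mem 2 i' = attackEntry n d lam x r f g i'

theorem run_rowFinish {n d : ℕ} {lam : ℝ} {x r : ℕ → ℝ} {f : ℝ → ℝ → ℝ} {g : ℝ → ℝ} {i : ℕ}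
    {out : ℕ → ℝ} {s : State} (hout : ∀ i' < i, out i' = attackEntry n d lam x r f g i')
    (h : ColumnInv n d lam x r f g i out n s) :
    RowInv n d lam x r f g (i + 1) (rowFinish.run s).1 ∧ (rowFinish.run s).2 ≤ 8 := by
  obtain ⟨⟨h0, h1, h4, h9, g0, g1, m0, m1⟩, h2, h3, h6, h5, g2, m2⟩ := h
  -- Both branches cost the same, so the test acts as a single update with a fixed cost of 2.
  have hif : ∀ t : State, (ifLt 2 1 (const 5 0) (const 5 1)).run t =
      ({ t with reg := Function.update t.reg 5 (if t.reg 2 < t.reg 1 then 0 else 1) }, 2) := by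
    intro t
    simp only [run]
    split_ifs <;> rfl
  set s₁ : State := ((seq (idxAdd 2 2 1) (seq (load 4 1 3) (seq (mul 4 4 0) (add 2 2 4)))).run s).1
    with hs₁
  have e : rowFinish.run s = (((seq (store 2 3 5) (idxAdd 3 3 4)).run
      ((ifLt 2 1 (const 5 0) (const 5 1)).run s₁).1).1,
      1 + (1 + (1 + (1 + (((ifLt 2 1 (const 5 0) (const 5 1)).run s₁).2 + 2))))) := rfl
  rw [e, hif]
  refine ⟨?_, le_rfl⟩
  rw [hs₁]
  refine ⟨⟨?_, ?_, ?_, ?_, ?_, ?_, ?_, ?_⟩, ?_, ?_, ?_⟩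
  -- The store touches only cell `i`: earlier outputs survive, and cell `i` receives the new one.
  on_goal 11 =>
    intro i' hi'
    rcases Nat.lt_succ_iff_lt_or_eq.1 hi' with hi' | rfl
    · simp [run, *, hi'.ne]
    · simp [run, *, attackEntry]
  all_goals simp [run, *, Nat.succ_mul]

theorem run_rowStep {n d : ℕ} {lam : ℝ} {x r : ℕ → ℝ} {f : ℝ → ℝ → ℝ} {g : ℝ → ℝ}
    {i c c' : ℕ} {P Q : Program} {s : State} (hP : P.CombinesEntries f c)
    (hQ : Q.Finishes g c') (h : RowInv n d lam x r f g i s) :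
    RowInv n d lam x r f g (i + 1) ((rowStep P Q).run s).1 ∧
      ((rowStep P Q).run s).2 ≤ n * (d * (c + 6) + c' + 8) + 12 := by
  obtain ⟨⟨h0, h1, h4, h9, g0, g1, m0, m1⟩, h2, h3, m2⟩ := h
  set s₁ : State := ((seq (idxConst 5 0) (seq (idxConst 6 0) (const 2 0))).run s).1 with hs₁
  have h₁ : ColumnInv n d lam x r f g i (s.mem 2) 0 s₁ := by
    refine ⟨⟨?_, ?_, ?_, ?_, ?_, ?_, ?_, ?_⟩, ?_, ?_, ?_, ?_, ?_, ?_⟩ <;>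
      simp [s₁, run, *]
  obtain ⟨h₂, ht₂⟩ := run_loop (u := 0) (N := n) (ColumnInv n d lam x r f g i (s.mem 2))
    h₁.idx0 h₁ fun k t _ ht => run_columnStep hP hQ ht
  obtain ⟨h₃, ht₃⟩ := run_rowFinish m2 h₂
  refine ⟨h₃, ?_⟩
  have e : ((rowStep P Q).run s).2 = 1 + (1 + (1 + (((loop 0 (columnStep P Q)).run s₁).2 +
      (rowFinish.run ((loop 0 (columnStep P Q)).run s₁).1).2))) := rfl
  change _ ≤ 1 + n * (d * (c + 6) + c' + 8) at ht₂
  rw [e]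
  omega

theorem run_attack {n d : ℕ} {lam : ℝ} {f : ℝ → ℝ → ℝ} {g : ℝ → ℝ} {c c' : ℕ} {P Q : Program}
    (hP : P.CombinesEntries f c) (hQ : Q.Finishes g c') (X : Matrix (Fin n) (Fin d) ℝ)
    (ρ : Fin n → ℝ) :
    RowInv n d lam ((inputState lam X ρ).mem 0) ((inputState lam X ρ).mem 1) f g n
        ((attack P Q).run (inputState lam X ρ)).1 ∧
      ((attack P Q).run (inputState lam X ρ)).2 ≤
        n * (n * (d * (c + 6) + c' + 8) + 13) + 3 := by
  set s := inputState lam X ρ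
  set s₁ : State := ((seq (idxConst 4 1) (const 1 (1 / 2))).run s).1 with hs₁
  have h₁ : RowInv n d lam (s.mem 0) (s.mem 1) f g 0 s₁ := by
    refine ⟨⟨?_, ?_, ?_, ?_, ?_, ?_, ?_, ?_⟩, ?_, ?_, ?_⟩ <;>
      simp [s₁, s, run, inputState]
  obtain ⟨h₂, ht₂⟩ := run_loop (u := 0) (N := n) (RowInv n d lam (s.mem 0) (s.mem 1) f g)
    h₁.idx0 h₁ fun k t _ ht => run_rowStep hP hQ ht
  refine ⟨h₂, ?_⟩
  have e : ((attack P Q).run s).2 = 1 + (1 + ((loop 0 (rowStep P Q)).run s₁).2) := rfl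
  change _ ≤ 1 + n * (n * (d * (c + 6) + c' + 8) + 13) at ht₂
  rw [e]
  omega

end Program

/-! ### From arrays back to matrices -/

theorem inputState_mem_zero {n d : ℕ} (lam : ℝ) (X : Matrix (Fin n) (Fin d) ℝ) (ρ : Fin n → ℝ)
    (i : Fin n) (k : Fin d) : (inputState lam X ρ).mem 0 (i * d + k) = X i k := by
  have hq : (i : ℕ) * d + k = (finProdFinEquiv (i, k) : Fin (n * d)) := by
    simp [finProdFinEquiv, mul_comm, add_comm]
  have hlt : (i : ℕ) * d + k < n * d := hq ▸ (finProdFinEquiv (i, k)).isLt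
  have e : (⟨(i : ℕ) * d + k, hlt⟩ : Fin (n * d)) = finProdFinEquiv (i, k) := Fin.ext hq
  simp only [inputState, if_true, dif_pos hlt, e, Equiv.symm_apply_apply]

theorem inputState_mem_one {n d : ℕ} (lam : ℝ) (X : Matrix (Fin n) (Fin d) ℝ) (ρ : Fin n → ℝ)
    (i : Fin n) : (inputState lam X ρ).mem 1 i = ρ i := by
  simp [inputState]

theorem regMatrix_mulVec {n d : ℕ} (κ : (Fin d → ℝ) → (Fin d → ℝ) → ℝ) (lam : ℝ)
    (X : Matrix (Fin n) (Fin d) ℝ) (v : Fin n → ℝ) (i : Fin n) :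
    (regMatrix κ lam X).mulVec v i = (∑ j, κ (X i) (X j) * v j) + lam * v i := by
  rw [regMatrix, Matrix.add_mulVec, Matrix.smul_mulVec, Matrix.one_mulVec]
  rfl

/-- Kernels that are a function of a sum over coordinates are attacked in time `O(d n ^ 2)`. -/
theorem computesAttack_attack {κ : ∀ d : ℕ, (Fin d → ℝ) → (Fin d → ℝ) → ℝ} {f : ℝ → ℝ → ℝ}
    {g : ℝ → ℝ} {c c' : ℕ} {P Q : Program} (hκ : ∀ d x y, κ d x y = g (∑ k, f (x k) (y k)))
    (hP : P.CombinesEntries f c) (hQ : Q.Finishes g c') :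
    ComputesAttack κ (P.attack Q) (c + c' + 30) := by
  intro n d hn hd lam X ρ
  obtain ⟨h, ht⟩ := Program.run_attack (lam := lam) hP hQ X ρ
  refine ⟨fun i => ?_, ht.trans ?_⟩
  · rw [h.mem2 i i.isLt, Program.attackEntry, roundingAttack, regMatrix_mulVec]
    simp only [Finset.sum_range, inputState_mem_zero, inputState_mem_one, hκ, mul_comm (ρ i)]
  -- The count is `(c + 6) d n ^ 2 + (c' + 8) n ^ 2 + 13 n + 3`; since `n ^ 2`, `n` and `1` are at
  -- most `d n ^ 2`, the constants add up to `6 + 8 + 13 + 3 = 30`.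
  · have h1 : n ≤ d * n ^ 2 := by nlinarith [Nat.mul_le_mul hd (Nat.mul_le_mul hn (le_refl n))]
    have h2 : n ^ 2 ≤ d * n ^ 2 := Nat.le_mul_of_pos_left _ hd
    have h3 : c' * n ^ 2 ≤ c' * (d * n ^ 2) := Nat.mul_le_mul le_rfl h2
    nlinarith

/-! ### Reconstruction by the rounding attack -/

theorem measurable_roundingAttack {n d : ℕ} (κ : (Fin d → ℝ) → (Fin d → ℝ) → ℝ) (lam : ℝ)
    (X : Matrix (Fin n) (Fin d) ℝ) : Measurable (roundingAttack κ lam X) := by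
  refine measurable_pi_lambda _ fun i => ?_
  refine Measurable.ite (measurableSet_lt ?_ measurable_const) measurable_const measurable_const
  simp only [regMatrix_mulVec]
  fun_prop

/-- The rounding attack is exact if the noise times the absolute row sums is below `1 / 2`. -/
theorem roundingAttack_eq {n d : ℕ} {κ : (Fin d → ℝ) → (Fin d → ℝ) → ℝ} {lam β S : ℝ}
    {X : Matrix (Fin n) (Fin d) ℝ} (hX : IsUnit (regMatrix κ lam X))
    (hS : ∀ i, ∑ j, |regMatrix κ lam X i j| ≤ S) (hβ : β * S < 1 / 2) {y ρ : Fin n → ℝ}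
    (hy : IsBinary y) (hρ : ∀ i, |ρ i - coeffs κ lam X y i| ≤ β) :
    roundingAttack κ lam X ρ = y := by
  funext i
  -- The sign of `β` is not assumed; it follows from the noise bound at the index `i`.
  have hβ0 : 0 ≤ β := (abs_nonneg _).trans (hρ i)
  have hy' : (regMatrix κ lam X).mulVec (coeffs κ lam X y) = y := by
    rw [coeffs, Matrix.mulVec_mulVec,
      Matrix.mul_nonsing_inv _ ((Matrix.isUnit_iff_isUnit_det _).1 hX), Matrix.one_mulVec]
  have hdiff : (regMatrix κ lam X).mulVec ρ i - y i =
      ∑ j, regMatrix κ lam X i j * (ρ j - coeffs κ lam X y j) := by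
    conv_lhs => rw [← hy']
    rw [← Pi.sub_apply, ← Matrix.mulVec_sub]
    rfl
  have herr : |(regMatrix κ lam X).mulVec ρ i - y i| < 1 / 2 := by
    rw [hdiff]
    calc |∑ j, regMatrix κ lam X i j * (ρ j - coeffs κ lam X y j)|
        ≤ ∑ j, |regMatrix κ lam X i j| * β := by
          refine (Finset.abs_sum_le_sum_abs _ _).trans (Finset.sum_le_sum fun j _ => ?_)
          rw [abs_mul]
          exact mul_le_mul_of_nonneg_left (hρ j) (abs_nonneg _)
      _ = β * ∑ j, |regMatrix κ lam X i j| := by rw [← Finset.sum_mul, mul_comm]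
      _ ≤ β * S := mul_le_mul_of_nonneg_left (hS i) hβ0
      _ < 1 / 2 := hβ
  rw [abs_lt] at herr
  rw [roundingAttack]
  rcases hy i with h | h <;> rw [h] at herr ⊢
  · exact if_pos (by linarith)
  · exact if_neg (by linarith)

theorem reconstructsWith_zero {n d : ℕ} {κ : (Fin d → ℝ) → (Fin d → ℝ) → ℝ} {lam β S : ℝ}
    {M : Mechanism n d n} (hM : ReleasesCoeffs κ lam β M)
    {X : Matrix (Fin n) (Fin d) ℝ} (hX : IsUnit (regMatrix κ lam X))
    (hS : ∀ i, ∑ j, |regMatrix κ lam X i j| ≤ S) (hβ : β * S < 1 / 2) :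
    ReconstructsWith M (roundingAttack κ lam) 0 0 := by
  refine ⟨measurable_roundingAttack κ lam, X, fun y hy => ?_⟩
  have hae : ∀ᵐ ρ ∂(M (database X y) : Measure (Fin n → ℝ)),
      ρ ∈ {ρ | (hammingDist y (roundingAttack κ lam X ρ) : ℝ) ≤ 0} ↔ ρ ∈ Set.univ := by
    filter_upwards [hM X y hy hX] with ρ hρ
    simp [roundingAttack_eq hX hS hβ hy hρ]
  rw [measureReal_congr (eventuallyEq_set.2 hae)]
  simp

/-- Hamming distance never exceeds `n`. This covers those `n` for which the noise is not yet small.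
-/
theorem reconstructsWith_card {n d : ℕ} (κ : (Fin d → ℝ) → (Fin d → ℝ) → ℝ) (lam : ℝ)
    (M : Mechanism n d n) : ReconstructsWith M (roundingAttack κ lam) n 0 := by
  refine ⟨measurable_roundingAttack κ lam, 0, fun y _ => ?_⟩
  have : {ρ | (hammingDist y (roundingAttack κ lam 0 ρ) : ℝ) ≤ n} = Set.univ := by
    refine Set.eq_univ_of_forall fun ρ => ?_
    simpa using hammingDist_le_card_fintype (x := y) (y := roundingAttack κ lam 0 ρ)
  rw [this]
  simp

theorem attributeNonprivate_of_reconstructsWith {d l : ℕ → ℕ} {M : ∀ n, Mechanism n (d n) (l n)}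
    {A : ∀ n, Matrix (Fin n) (Fin (d n)) ℝ → (Fin (l n) → ℝ) → (Fin n → ℝ)} {θ γ : ℕ → ℝ}
    (hθ : θ =o[atTop] fun n : ℕ => (n : ℝ)) (hγ : Tendsto γ atTop (𝓝 0))
    (h : ∀ n, ReconstructsWith (M n) (A n) (θ n) (γ n)) : AttributeNonprivate M :=
  ⟨id, strictMono_id, θ, γ, hθ, hγ, fun n => ⟨A n, h n⟩⟩

/-- If for each `n` some invertible regularized kernel matrix has absolute row sums at most
`C * T n`, the rounding attack withstands noise `o(1 / T)`. -/
theorem exists_reconstructsWith {d : ℕ → ℕ} {κ : ∀ n, (Fin (d n) → ℝ) → (Fin (d n) → ℝ) → ℝ}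
    {lam β T : ℕ → ℝ} {C : ℝ} {M : ∀ n, Mechanism n (d n) n} (hC : 0 < C) (hT : ∀ n, 0 < T n)
    (hX : ∀ n, ∃ X : Matrix (Fin n) (Fin (d n)) ℝ, IsUnit (regMatrix (κ n) (lam n) X) ∧
      ∀ i, ∑ j, |regMatrix (κ n) (lam n) X i j| ≤ C * T n)
    (hβ : β =o[atTop] fun n => 1 / T n)
    (hM : ∀ n, ReleasesCoeffs (κ n) (lam n) (β n) (M n)) :
    ∃ θ γ : ℕ → ℝ, (θ =o[atTop] fun n : ℕ => (n : ℝ)) ∧ Tendsto γ atTop (𝓝 0) ∧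
      ∀ n, ReconstructsWith (M n) (roundingAttack (κ n) (lam n)) (θ n) (γ n) := by
  refine ⟨fun n => if β n * (C * T n) < 1 / 2 then 0 else n, fun _ => 0, ?_,
    tendsto_const_nhds, fun n => ?_⟩
  · have hev : ∀ᶠ n in atTop, β n * (C * T n) < 1 / 2 := by
      -- The constant `1 / (4 * C)` turns the error bound into `1 / 4`.
      filter_upwards [hβ.bound (c := 1 / (4 * C)) (by positivity)] with n hn
      have hTn := hT n
      rw [Real.norm_eq_abs, Real.norm_eq_abs, abs_of_pos (one_div_pos.2 hTn)] at hn
      calc β n * (C * T n) ≤ 1 / (4 * C) * (1 / T n) * (C * T n) :=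
            mul_le_mul_of_nonneg_right ((le_abs_self _).trans hn) (by positivity)
        _ = 1 / 4 := by field_simp
        _ < 1 / 2 := by norm_num
    refine (isLittleO_zero (fun n : ℕ => (n : ℝ)) atTop).congr' ?_ EventuallyEq.rfl
    filter_upwards [hev] with n hn
    rw [if_pos hn]
  · dsimp only
    split_ifs with h
    · obtain ⟨X, hu, hS⟩ := hX n
      exact reconstructsWith_zero (hM n) hu hS h
    · exact reconstructsWith_card _ _ _

theorem regMatrix_apply {n d : ℕ} (κ : (Fin d → ℝ) → (Fin d → ℝ) → ℝ) (lam : ℝ)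
    (X : Matrix (Fin n) (Fin d) ℝ) (i j : Fin n) :
    regMatrix κ lam X i j = κ (X i) (X j) + if i = j then lam else 0 := by
  simp [regMatrix, kernelMatrix, Matrix.one_apply]

theorem sum_abs_regMatrix_le {n d : ℕ} (κ : (Fin d → ℝ) → (Fin d → ℝ) → ℝ) {lam : ℝ}
    (hlam : 0 ≤ lam) (X : Matrix (Fin n) (Fin d) ℝ) (i : Fin n) :
    ∑ j, |regMatrix κ lam X i j| ≤ (∑ j, |κ (X i) (X j)|) + lam := by
  calc ∑ j, |regMatrix κ lam X i j|
      ≤ ∑ j, (|κ (X i) (X j)| + if i = j then lam else 0) := by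
        refine Finset.sum_le_sum fun j _ => ?_
        rw [regMatrix_apply]
        refine (abs_add_le _ _).trans (add_le_add le_rfl ?_)
        split_ifs <;> simp [abs_of_nonneg hlam]
    _ = _ := by simp [Finset.sum_add_distrib]

/-! ### The polynomial kernel -/

/-- On the cube the inner product is at most `d`, and `1 ≤ d` lets the offset `b` be absorbed into
the same factor. -/
theorem abs_polyKernel_le (a b : ℝ) (p : ℕ) {d : ℕ} (hd : 1 ≤ d) {x y : Fin d → ℝ}
    (hx : ∀ k, |x k| ≤ 1) (hy : ∀ k, |y k| ≤ 1) :
    |polyKernel a b p x y| ≤ (|a| + |b|) ^ p * (d : ℝ) ^ p := by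
  have hd' : (1 : ℝ) ≤ d := by exact_mod_cast hd
  have hxy : |∑ k, x k * y k| ≤ d := by
    calc |∑ k, x k * y k| ≤ ∑ k : Fin d, (1 : ℝ) := by
          refine (Finset.abs_sum_le_sum_abs _ _).trans (Finset.sum_le_sum fun k _ => ?_)
          rw [abs_mul]
          exact mul_le_one₀ (hx k) (abs_nonneg _) (hy k)
      _ = d := by simp
  rw [polyKernel, abs_pow, ← mul_pow]
  refine pow_le_pow_left₀ (abs_nonneg _) ?_ p
  calc |a * (∑ k, x k * y k) + b| ≤ |a| * |∑ k, x k * y k| + |b| := by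
        rw [← abs_mul]; exact abs_add_le _ _
    _ ≤ |a| * d + |b| * d :=
        add_le_add (mul_le_mul_of_nonneg_left hxy (abs_nonneg a))
          (le_mul_of_one_le_right (abs_nonneg b) hd')
    _ = (|a| + |b|) * d := by ring

theorem sum_abs_regMatrix_polyKernel_le (a b : ℝ) (p : ℕ) {n d : ℕ} (hd : 1 ≤ d) {lam : ℝ}
    (hlam : 0 ≤ lam) {X : Matrix (Fin n) (Fin d) ℝ} (hX : ∀ i k, |X i k| ≤ 1) (i : Fin n) :
    ∑ j, |regMatrix (polyKernel a b p) lam X i j| ≤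
      ((|a| + |b|) ^ p + 1) * ((d : ℝ) ^ p * n + lam) := by
  refine (sum_abs_regMatrix_le _ hlam X i).trans ?_
  have h1 : ∑ j, |polyKernel a b p (X i) (X j)| ≤ n * ((|a| + |b|) ^ p * (d : ℝ) ^ p) := by
    simpa using Finset.sum_le_sum fun j (_ : j ∈ Finset.univ) =>
      abs_polyKernel_le a b p hd (hX i) (hX j)
  have h2 : 0 ≤ (|a| + |b|) ^ p * lam := by positivity
  have h3 : 0 ≤ (d : ℝ) ^ p * n := by positivity
  linarith

/-- Summing the equations of a kernel vector `v` gives `(n * c + lam) * ∑ v = 0`. Hence `∑ v = 0`,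
and each equation reduces to `lam * v i = 0`. -/
theorem isUnit_regMatrix_of_const {n d : ℕ} {κ : (Fin d → ℝ) → (Fin d → ℝ) → ℝ} {lam c : ℝ}
    {X : Matrix (Fin n) (Fin d) ℝ} (hκ : ∀ i j, κ (X i) (X j) = c) (hlam : lam ≠ 0)
    (hc : n * c + lam ≠ 0) : IsUnit (regMatrix κ lam X) := by
  rw [← Matrix.mulVec_injective_iff_isUnit]
  refine (injective_iff_map_eq_zero (regMatrix κ lam X).mulVecLin).2 fun v hv => ?_
  have hrow : ∀ i, c * (∑ j, v j) + lam * v i = 0 := by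
    intro i
    have := congrFun hv i
    rwa [Matrix.mulVecLin_apply, regMatrix_mulVec, Pi.zero_apply,
      Finset.sum_congr rfl fun j _ => by rw [hκ i j], ← Finset.mul_sum] at this
  have hsum : (n * c + lam) * ∑ j, v j = 0 := by
    have := Finset.sum_congr rfl fun i (_ : i ∈ Finset.univ) => hrow i
    rw [Finset.sum_add_distrib, ← Finset.mul_sum Finset.univ v] at this
    simp only [Finset.sum_const, Finset.card_univ, Fintype.card_fin, nsmul_eq_mul, mul_zero] at this
    linarith
  funext i
  simpa [(mul_eq_zero.1 hsum).resolve_left hc, hlam] using hrow i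

theorem exists_isUnit_regMatrix_polyKernel {a b : ℝ} (p n d : ℕ) (hb : 0 ≤ b) {lam : ℝ}
    (hlam : 0 < lam) : ∃ X : Matrix (Fin n) (Fin d) ℝ, (∀ i k, 0 < X i k ∧ X i k ≤ 1) ∧
      IsUnit (regMatrix (polyKernel a b p) lam X) := by
  have hcont : Continuous fun t : ℝ => n * (a * (d * (t * t)) + b) ^ p + lam := by fun_prop
  -- At `t = 0` the value is `n * b ^ p + lam`, positive because `0 ≤ b`. By continuity it stays
  -- positive for small `t > 0`, even if `a` is negative.
  have hev : ∀ᶠ t in 𝓝[>] (0 : ℝ), 0 < n * (a * (d * (t * t)) + b) ^ p + lam := by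
    refine (hcont.tendsto 0).eventually (lt_mem_nhds ?_) |>.filter_mono nhdsWithin_le_nhds
    have : 0 ≤ (n : ℝ) * b ^ p := by positivity
    simpa using add_pos_of_nonneg_of_pos this hlam
  obtain ⟨t, ht, h0, h1⟩ := (hev.and (Ioc_mem_nhdsGT one_pos)).exists
  refine ⟨Matrix.of fun _ _ => t, fun _ _ => ⟨h0, h1⟩,
    isUnit_regMatrix_of_const (fun i j => ?_) hlam.ne' ht.ne'⟩
  simp [polyKernel]

/-! ### The Gaussian kernel -/

/-- Each off-diagonal entry is at most `exp (-n)`, and `n * exp (-n) < 1`. This gives both diagonal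
dominance and the bound on row sums. -/
theorem sum_gaussKernel_lt_one {n d : ℕ} {a : ℝ} {X : Matrix (Fin n) (Fin d) ℝ}
    (hX : ∀ i j, i ≠ j → (n : ℝ) ≤ a * ∑ k, (X i k - X j k) ^ 2) (i : Fin n) :
    ∑ j ∈ Finset.univ.erase i, gaussKernel a (X i) (X j) < 1 := by
  calc ∑ j ∈ Finset.univ.erase i, gaussKernel a (X i) (X j)
      ≤ ∑ j ∈ Finset.univ.erase i, Real.exp (-n) := by
        refine Finset.sum_le_sum fun j hj => Real.exp_le_exp.2 ?_
        have := hX i j (Finset.ne_of_mem_erase hj).symm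
        linarith
    _ ≤ ∑ _j : Fin n, Real.exp (-n) :=
        Finset.sum_le_sum_of_subset_of_nonneg (Finset.subset_univ _)
          fun _ _ _ => (Real.exp_pos _).le
    _ = n * Real.exp (-n) := by simp
    _ < Real.exp n * Real.exp (-n) := by
        refine mul_lt_mul_of_pos_right ?_ (Real.exp_pos _)
        linarith [Real.add_one_le_exp (n : ℝ)]
    _ = 1 := by rw [← Real.exp_add, add_neg_cancel, Real.exp_zero]

theorem gaussKernel_self (a : ℝ) {d : ℕ} (x : Fin d → ℝ) : gaussKernel a x x = 1 := by
  simp [gaussKernel]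

theorem gaussKernel_pos (a : ℝ) {d : ℕ} (x y : Fin d → ℝ) : 0 < gaussKernel a x y :=
  Real.exp_pos _

/-- Strict diagonal dominance: the diagonal entry is `1 + lam`. -/
theorem isUnit_regMatrix_gaussKernel {n d : ℕ} {a lam : ℝ} (hlam : 0 < lam)
    {X : Matrix (Fin n) (Fin d) ℝ}
    (hX : ∀ i j, i ≠ j → (n : ℝ) ≤ a * ∑ k, (X i k - X j k) ^ 2) :
    IsUnit (regMatrix (gaussKernel a) lam X) := by
  rw [Matrix.isUnit_iff_isUnit_det, isUnit_iff_ne_zero]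
  refine det_ne_zero_of_sum_row_lt_diag fun i => ?_
  calc ∑ j ∈ Finset.univ.erase i, ‖regMatrix (gaussKernel a) lam X i j‖
      = ∑ j ∈ Finset.univ.erase i, gaussKernel a (X i) (X j) := by
        refine Finset.sum_congr rfl fun j hj => ?_
        rw [regMatrix_apply, if_neg (Finset.ne_of_mem_erase hj).symm, add_zero,
          Real.norm_of_nonneg (gaussKernel_pos _ _ _).le]
    _ < 1 := sum_gaussKernel_lt_one hX i
    _ ≤ ‖regMatrix (gaussKernel a) lam X i i‖ := by
        rw [regMatrix_apply, if_pos rfl, gaussKernel_self, Real.norm_of_nonneg (by linarith)]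
        linarith

theorem sum_abs_regMatrix_gaussKernel_le {n d : ℕ} {a lam : ℝ} (hlam : 0 < lam)
    {X : Matrix (Fin n) (Fin d) ℝ}
    (hX : ∀ i j, i ≠ j → (n : ℝ) ≤ a * ∑ k, (X i k - X j k) ^ 2) (i : Fin n) :
    ∑ j, |regMatrix (gaussKernel a) lam X i j| ≤ 2 + lam := by
  refine (sum_abs_regMatrix_le _ hlam.le X i).trans ?_
  simp only [abs_of_pos (gaussKernel_pos _ _ _)]
  rw [← Finset.add_sum_erase _ _ (Finset.mem_univ i), gaussKernel_self]
  linarith [sum_gaussKernel_lt_one hX i]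

theorem exists_separated_rows {a : ℝ} (ha : 0 < a) (n : ℕ) {d : ℕ} (hd : 1 ≤ d) :
    ∃ X : Matrix (Fin n) (Fin d) ℝ,
      ∀ i j, i ≠ j → (n : ℝ) ≤ a * ∑ k, (X i k - X j k) ^ 2 := by
  -- Equally spaced points on a line, with the spacing chosen so that `a` times the squared distance
  -- is `n * d * (i - j) ^ 2`.
  refine ⟨Matrix.of fun i _ => Real.sqrt (n / a) * (i : ℕ), fun i j hij => ?_⟩
  have hd' : (1 : ℝ) ≤ d := by exact_mod_cast hd
  have hsq : (1 : ℝ) ≤ (((i : ℕ) : ℝ) - (j : ℕ)) ^ 2 := by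
    have h : ((i : ℕ) : ℤ) - (j : ℕ) ≠ 0 := by
      rw [sub_ne_zero]
      exact_mod_cast Fin.val_ne_of_ne hij
    exact_mod_cast Int.add_one_le_of_lt (sq_pos_of_ne_zero h)
  have hval : a * ∑ k : Fin d, ((Matrix.of fun (i : Fin n) (_ : Fin d) =>
      Real.sqrt (n / a) * (i : ℕ)) i k - (Matrix.of fun (i : Fin n) (_ : Fin d) =>
      Real.sqrt (n / a) * (i : ℕ)) j k) ^ 2 = n * (d * (((i : ℕ) : ℝ) - (j : ℕ)) ^ 2) := by
    simp only [Matrix.of_apply, ← mul_sub, mul_pow, Real.sq_sqrt (div_nonneg n.cast_nonneg ha.le)]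
    simp only [Finset.sum_const, Finset.card_univ, Fintype.card_fin, nsmul_eq_mul]
    field_simp
  rw [hval]
  exact le_mul_of_one_le_right n.cast_nonneg (one_le_mul_of_one_le_of_one_le hd' hsq)

end KRR

end

theorem proposition3 :
    -- polynomial kernel
    (∀ (a b : ℝ) (p : ℕ), 0 ≤ b →
      -- the attack runs in time `O(d n ^ 2)`
      (∃ (P : KRR.Program) (C : ℕ), KRR.ComputesAttack (fun _ => KRR.polyKernel a b p) P C) ∧
      ∀ (d : ℕ → ℕ) (lam β : ℕ → ℝ) (M : ∀ n, KRR.Mechanism n (d n) n),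
        (∀ n, 1 ≤ d n) → (∀ n, 0 < lam n) →
        (β =o[atTop] fun n : ℕ => 1 / ((d n : ℝ) ^ p * (n : ℝ) + lam n)) →
        (∀ n, KRR.ReleasesCoeffs (KRR.polyKernel a b p) (lam n) (β n) (M n)) →
        KRR.AttributeNonprivate M ∧
        -- and this is achieved by the attack, for all `n`
        ∃ θ γ : ℕ → ℝ, (θ =o[atTop] fun n : ℕ => (n : ℝ)) ∧ Tendsto γ atTop (𝓝 0) ∧
          ∀ n, KRR.ReconstructsWith (M n)
            (KRR.roundingAttack (KRR.polyKernel a b p) (lam n)) (θ n) (γ n)) ∧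
    -- Gaussian kernel
    (∀ a : ℝ, 0 < a →
      (∃ (P : KRR.Program) (C : ℕ), KRR.ComputesAttack (fun _ => KRR.gaussKernel a) P C) ∧
      ∀ (d : ℕ → ℕ) (lam β : ℕ → ℝ) (M : ∀ n, KRR.Mechanism n (d n) n),
        (∀ n, 1 ≤ d n) → (∀ n, 0 < lam n) →
        (β =o[atTop] fun n : ℕ => 1 / (2 + lam n)) →
        (∀ n, KRR.ReleasesCoeffs (KRR.gaussKernel a) (lam n) (β n) (M n)) →
        KRR.AttributeNonprivate M ∧
        ∃ θ γ : ℕ → ℝ, (θ =o[atTop] fun n : ℕ => (n : ℝ)) ∧ Tendsto γ atTop (𝓝 0) ∧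
          ∀ n, KRR.ReconstructsWith (M n)
            (KRR.roundingAttack (KRR.gaussKernel a) (lam n)) (θ n) (γ n)) := by

  refine ⟨fun a b p hb => ⟨⟨_, _, KRR.computesAttack_attack (fun _ _ _ => rfl)
    KRR.Program.combinesEntries_mul (KRR.Program.finishes_polyFinish a b p)⟩, ?_⟩,
    fun a ha => ⟨⟨_, _, KRR.computesAttack_attack (fun _ _ _ => rfl)
    KRR.Program.combinesEntries_sqDiff (KRR.Program.finishes_gaussFinish a)⟩, ?_⟩⟩
  · intro d lam β M hd hlam hβ hM
    -- The summand `1` in `C` pays for `lam` and keeps `C` positive when `a = b = 0`.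
    have hrec := KRR.exists_reconstructsWith (C := (|a| + |b|) ^ p + 1) (by positivity)
      (fun n => add_pos_of_nonneg_of_pos (by positivity) (hlam n)) (fun n => by
        obtain ⟨X, hX, hu⟩ :=
          KRR.exists_isUnit_regMatrix_polyKernel (a := a) p n (d n) hb (hlam n)
        exact ⟨X, hu, KRR.sum_abs_regMatrix_polyKernel_le a b p (hd n) (hlam n).le
          fun i k => abs_le.2 ⟨by linarith [(hX i k).1], (hX i k).2⟩⟩) hβ hM
    refine ⟨?_, hrec⟩
    obtain ⟨θ, γ, hθ, hγ, h⟩ := hrec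
    exact KRR.attributeNonprivate_of_reconstructsWith hθ hγ h
  · intro d lam β M hd hlam hβ hM
    have hrec := KRR.exists_reconstructsWith (C := 1) one_pos
      (fun n => add_pos_of_nonneg_of_pos zero_le_two (hlam n)) (fun n => by
        obtain ⟨X, hX⟩ := KRR.exists_separated_rows ha n (hd n)
        exact ⟨X, KRR.isUnit_regMatrix_gaussKernel (hlam n) hX, fun i =>
          (KRR.sum_abs_regMatrix_gaussKernel_le (hlam n) hX i).trans_eq (one_mul _).symm⟩) hβ hM
    refine ⟨?_, hrec⟩
    obtain ⟨θ, γ, hθ, hγ, h⟩ := hrec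
    exact KRR.attributeNonprivate_of_reconstructsWith hθ hγ h
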